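/- Theorem 4.2. Let $\ell_\infty$ be the Banach space of bounded sequences of scalars (real or complex) with the supremum norm, and let $L(\ell_\infty)$ be the Banach algebra of all bounded linear operators on $\ell_\infty$ with the operator norm. Then $L(\ell_\infty)$ has a continuum of distinct closed ideals; that is, there is a set $S$ of norm-closed two-sided ideals of $L(\ell_\infty)$ whose cardinality is $2^{\aleph_0}$. -/

import Mathlib

open scoped ENNReal

/-- The Banach space `ℓ_∞` of bounded `𝕜`-valued sequences with the supremum norm. It is Mathlib's
`lp (fun _ : ℕ => 𝕜) ∞`, kept under a name of its own so that only its Banach space structure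
(and not the pointwise product of sequences) is visible. -/
def EllInfty (𝕜 : Type) [RCLike 𝕜] : Type :=
  lp (fun _ : ℕ => 𝕜) ∞

namespace EllInfty

noncomputable instance instNormedAddCommGroup (𝕜 : Type) [RCLike 𝕜] :
    NormedAddCommGroup (EllInfty 𝕜) :=
  inferInstanceAs (NormedAddCommGroup (lp (fun _ : ℕ => 𝕜) ∞))

noncomputable instance instNormedSpace (𝕜 : Type) [RCLike 𝕜] : NormedSpace 𝕜 (EllInfty 𝕜) :=
  inferInstanceAs (NormedSpace 𝕜 (lp (fun _ : ℕ => 𝕜) ∞))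

instance instCompleteSpace (𝕜 : Type) [RCLike 𝕜] : CompleteSpace (EllInfty 𝕜) :=
  inferInstanceAs (CompleteSpace (lp (fun _ : ℕ => 𝕜) ∞))

end EllInfty

section SignFunctions

/-- A sign function on `ZMod 2`. -/
def zmodSign (c : ZMod 2) : ℝ := if c = 0 then 1 else -1

lemma zmodSign_add (c d : ZMod 2) : zmodSign (c + d) = zmodSign c * zmodSign d := by
  have h : ∀ c : ZMod 2, c = 0 ∨ c = 1 := by decide
  have h2 : (1 + 1 : ZMod 2) = 0 := rfl
  rcases h c with rfl | rfl <;> rcases h d with rfl | rfl <;> simp [zmodSign, h2]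

lemma zmodSign_sq (c : ZMod 2) : zmodSign c * zmodSign c = 1 := by
  unfold zmodSign; split_ifs <;> norm_num

lemma sum_zmodSign_mul_eq_zero {F : Type*} [Field F] [Fintype F] [Algebra (ZMod 2) F]
    (φ : F →ₗ[ZMod 2] ZMod 2) (hφ : φ 1 = 1) {c : F} (hc : c ≠ 0) :
    ∑ b : F, zmodSign (φ (b * c)) = 0 := by
  have h : ∑ b : F, zmodSign (φ (b * c)) = ∑ b : F, zmodSign (φ ((b + c⁻¹) * c)) :=
    (Equiv.sum_comp (Equiv.addRight c⁻¹) fun b => zmodSign (φ (b * c))).symm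
  have h2 : ∀ b : F, zmodSign (φ ((b + c⁻¹) * c)) = - zmodSign (φ (b * c)) := by
    intro b
    rw [add_mul, inv_mul_cancel₀ hc, map_add, hφ, zmodSign_add]
    simp [zmodSign]
  simp only [h2, Finset.sum_neg_distrib] at h
  linarith

open Polynomial in
/-- Reed–Solomon words of degree at most three, concatenated with a Hadamard code, give many
pairwise almost orthogonal sign functions. -/
lemma exists_signs_of_field {F : Type*} [Field F] [Fintype F] [Algebra (ZMod 2) F] :
    ∃ y : {f : Polynomial.degreeLT F 4 // f ≠ 0} → F × F → ℝ,
      (∀ k a, y k a * y k a = 1) ∧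
      (∀ k, |∑ a, y k a| ≤ 3 * Fintype.card F) ∧
      (∀ k l, k ≠ l → |∑ a, y k a * y l a| ≤ 3 * Fintype.card F) := by
  classical
  obtain ⟨φ, hφ⟩ : ∃ φ : F →ₗ[ZMod 2] ZMod 2, φ 1 = 1 :=
    Module.Projective.exists_dual_eq_one (ZMod 2) one_ne_zero
  have key : ∀ f : F[X], f ∈ Polynomial.degreeLT F 4 → f ≠ 0 →
      |∑ a : F × F, zmodSign (φ (a.2 * f.eval a.1))| ≤ 3 * Fintype.card F := by
    intro f hf hf0
    rw [Fintype.sum_prod_type]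
    have h1 : ∀ a : F, ∑ b : F, zmodSign (φ (b * f.eval a)) =
        if a ∈ f.roots.toFinset then (Fintype.card F : ℝ) else 0 := by
      intro a
      split_ifs with ha
      · have : f.eval a = 0 := by simpa [hf0] using ha
        simp [this, zmodSign]
      · have : f.eval a ≠ 0 := by simpa [hf0] using ha
        exact sum_zmodSign_mul_eq_zero φ hφ this
    simp only [h1]
    rw [Finset.sum_ite_mem, Finset.univ_inter, Finset.sum_const, nsmul_eq_mul,
      abs_of_nonneg (by positivity)]
    gcongr
    have h2 : f.roots.toFinset.card ≤ 3 := by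
      refine (Multiset.toFinset_card_le _).trans ((Polynomial.card_roots' f).trans ?_)
      have := (Polynomial.natDegree_lt_iff_degree_lt hf0).2 (Polynomial.mem_degreeLT.1 hf)
      omega
    exact_mod_cast h2
  refine ⟨fun k a => zmodSign (φ (a.2 * (k.1 : F[X]).eval a.1)), fun k a => zmodSign_sq _,
    fun k => key _ k.1.2 (by simpa using k.2), fun k l hkl => ?_⟩
  have h3 : ((k.1 - l.1 : Polynomial.degreeLT F 4) : F[X]) ≠ 0 := by
    intro h
    exact hkl (Subtype.ext (sub_eq_zero.1 (Subtype.ext h)))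
  have h4 := key _ (k.1 - l.1).2 h3
  convert h4 using 3 with a
  rw [← zmodSign_add, ← map_add, ← mul_add]
  congr 3
  have hl : (l.1 : F[X]).eval a.1 + (l.1 : F[X]).eval a.1 = 0 := by
    have := charP_of_injective_algebraMap (algebraMap (ZMod 2) F).injective 2
    rw [← two_mul, CharTwo.two_eq_zero, zero_mul]
  simp only [Submodule.coe_sub, Polynomial.eval_sub]
  linear_combination hl

/-- For every `R` there are finitely many points and at least `R` times as many sign functions on
them, with means and pairwise correlations at most `1 / R`. -/
lemma exists_signs (R : ℕ) :
    ∃ (n N : ℕ) (y : Fin N → Fin n → ℝ), 0 < n ∧ R * n ≤ N ∧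
      (∀ k a, y k a * y k a = 1) ∧
      (∀ k, R * |∑ a, y k a| ≤ n) ∧
      (∀ k l, k ≠ l → R * |∑ a, y k a * y l a| ≤ n) := by
  classical
  let r := 3 * R + 2
  let F := GaloisField 2 r
  have : Fintype F := Fintype.ofFinite F
  have hq : Fintype.card F = 2 ^ r := by
    rw [← Nat.card_eq_fintype_card]; exact GaloisField.card 2 r (by omega)
  have hr : r < 2 ^ r := Nat.lt_two_pow_self
  set q := Fintype.card F with hqdef
  obtain ⟨y, h1, h2, h3⟩ := exists_signs_of_field (F := F)
  have : Finite (Polynomial.degreeLT F 4) :=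
    Finite.of_equiv _ (Polynomial.degreeLTEquiv F 4).toEquiv.symm
  have : Fintype {f : Polynomial.degreeLT F 4 // f ≠ 0} := Fintype.ofFinite _
  have : Fintype (Polynomial.degreeLT F 4) := Fintype.ofFinite _
  have hK : Fintype.card {f : Polynomial.degreeLT F 4 // f ≠ 0} = q ^ 4 - 1 := by
    rw [Fintype.card_subtype_compl, Fintype.card_subtype_eq,
      Fintype.card_congr (Polynomial.degreeLTEquiv F 4).toEquiv]
    simp [hqdef]
  let eK := Fintype.equivFin {f : Polynomial.degreeLT F 4 // f ≠ 0}
  let eG := Fintype.equivFin (F × F)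
  have hG : Fintype.card (F × F) = q * q := Fintype.card_prod F F
  have hqR : 3 * R + 2 ≤ q := by omega
  have hqR' : (3 * R : ℝ) ≤ q := by
    have : 3 * R ≤ q := by omega
    exact_mod_cast this
  have hb : ∀ t : ℝ, t ≤ 3 * q → R * t ≤ (Fintype.card (F × F) : ℕ) := by
    intro t ht
    rw [hG]; push_cast
    calc (R : ℝ) * t ≤ R * (3 * q) := by gcongr
      _ = (3 * R) * q := by ring
      _ ≤ q * q := by gcongr
  refine ⟨Fintype.card (F × F), _, fun k a => y (eK.symm k) (eG.symm a), ?_, ?_,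
    fun k a => h1 _ _, fun k => ?_, fun k l hkl => ?_⟩
  · rw [hG]; exact Nat.mul_pos (by omega) (by omega)
  · rw [hK, hG]
    apply Nat.le_sub_of_add_le
    have h5 : R + 1 ≤ q := by omega
    have h6 : 1 ≤ q := by omega
    nlinarith [Nat.mul_le_mul h5 (Nat.mul_le_mul h6 (Nat.mul_le_mul h6 h6)), Nat.mul_le_mul h6 h6,
      Nat.mul_le_mul h5 (Nat.mul_le_mul h6 (le_refl (q * q))), Nat.mul_le_mul h6 (le_refl (q * q))]
  · rw [Equiv.sum_comp eG.symm (y (eK.symm k))]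
    exact hb _ (h2 _)
  · rw [Equiv.sum_comp eG.symm (fun a => y (eK.symm k) a * y (eK.symm l) a)]
    exact hb _ (h3 _ _ fun h => hkl (eK.symm.injective h))

/-- A sequence of levels; level `i` has `n i` points and `N i` almost orthogonal sign functions on
them, with parameters growing rapidly. -/
structure SignSystem where
  n : ℕ → ℕ
  N : ℕ → ℕ
  R : ℕ → ℕ
  sgn : (i : ℕ) → Fin (N i) → Fin (n i) → ℝ
  n_pos : ∀ i, 0 < n i
  mul_le : ∀ i, R i * n i ≤ N i
  sgn_mul_self : ∀ i k a, sgn i k a * sgn i k a = 1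
  mean_le : ∀ i k, R i * |∑ a, sgn i k a| ≤ n i
  corr_le : ∀ i k l, k ≠ l → R i * |∑ a, sgn i k a * sgn i l a| ≤ n i
  R_zero : 0 < R 0
  growth : ∀ i, (i + 2) * (1 + R i + N i) ≤ R (i + 1)

lemma SignSystem.nonempty : Nonempty SignSystem := by
  choose n N y h1 h2 h3 h4 h5 using exists_signs
  let R : ℕ → ℕ := fun i => Nat.rec 1 (fun i r => (i + 2) * (1 + r + N r)) i
  exact ⟨⟨fun i => n (R i), fun i => N (R i), R, fun i => y (R i), fun i => h1 _, fun i => h2 _,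
    fun i => h3 _, fun i => h4 _, fun i => h5 _, Nat.one_pos, fun i => le_rfl⟩⟩

namespace SignSystem

variable (S : SignSystem)

lemma R_pos (i : ℕ) : 0 < S.R i := by
  cases i with
  | zero => exact S.R_zero
  | succ i => exact lt_of_lt_of_le (by positivity) (S.growth i)

lemma R_strictMono : StrictMono S.R := by
  refine strictMono_nat_of_lt_succ fun i => lt_of_lt_of_le ?_ (S.growth i)
  nlinarith [Nat.zero_le (S.N i), Nat.zero_le (S.R i), Nat.zero_le (i * S.R i),
    Nat.zero_le (i * S.N i)]

lemma sum_N_le (i : ℕ) : ∑ j ∈ Finset.range i, S.N j ≤ S.R i := by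
  induction i with
  | zero => simp
  | succ i ih =>
    rw [Finset.sum_range_succ]
    refine le_trans ?_ (S.growth i)
    nlinarith [Nat.zero_le (i * (1 + S.R i + S.N i))]

lemma mul_sum_N_le (i : ℕ) : (i + 1) * ∑ j ∈ Finset.range i, S.N j ≤ S.R i := by
  cases i with
  | zero => simp
  | succ i =>
    rw [Finset.sum_range_succ]
    refine le_trans (Nat.mul_le_mul le_rfl ?_) (S.growth i)
    have := S.sum_N_le i
    omega

lemma le_R (i : ℕ) : i + 1 ≤ S.R i := by
  cases i with
  | zero => exact S.R_zero
  | succ i =>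
    refine le_trans ?_ (S.growth i)
    nlinarith [Nat.zero_le ((i + 2) * (S.R i + S.N i))]

lemma n_le_N (i : ℕ) : S.n i ≤ S.N i :=
  le_trans (Nat.le_mul_of_pos_left _ (S.R_pos i)) (S.mul_le i)

lemma mul_n_le {i j : ℕ} (h : i < j) : (i + 2) * S.n i ≤ S.R j := by
  refine le_trans ?_ ((S.growth i).trans (S.R_strictMono.monotone h))
  exact Nat.mul_le_mul le_rfl ((S.n_le_N i).trans (by omega))

lemma abs_sgn (i : ℕ) (k : Fin (S.N i)) (a : Fin (S.n i)) : |S.sgn i k a| = 1 := by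
  have h := S.sgn_mul_self i k a
  rw [← abs_mul_abs_self] at h
  nlinarith [abs_nonneg (S.sgn i k a)]

end SignSystem

end SignFunctions

namespace SignSystem

variable (S : SignSystem)

/-- The number of points in the product of the first `s` levels. -/
def size (s : ℕ) : ℕ := ∏ j ∈ Finset.range s, S.n j

lemma size_pos (s : ℕ) : 0 < S.size s := Finset.prod_pos fun j _ => S.n_pos j

lemma size_succ (s : ℕ) : S.size (s + 1) = S.size s * S.n s := Finset.prod_range_succ _ _

lemma size_dvd {i s : ℕ} (h : i ≤ s) : S.size i ∣ S.size s :=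
  Finset.prod_dvd_prod_of_subset _ _ _ (Finset.range_mono h)

/-- The `i`-th digit of a natural number in the mixed radix system with radices `S.n`. -/
def digit (i t : ℕ) : Fin (S.n i) := ⟨t / S.size i % S.n i, Nat.mod_lt _ (S.n_pos i)⟩

lemma digit_add_of_lt {i s : ℕ} (h : i < s) (u v : ℕ) :
    S.digit i (u + S.size s * v) = S.digit i u := by
  obtain ⟨c, hc⟩ := S.size_dvd (Nat.succ_le_of_lt h)
  rw [Nat.succ_eq_add_one, size_succ] at hc
  ext
  simp only [digit]
  rw [hc, show u + S.size i * S.n i * c * v = u + S.size i * (S.n i * (c * v)) by ring,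
    Nat.add_mul_div_left _ _ (S.size_pos i), Nat.add_mul_mod_self_left]

lemma digit_add_self {s u : ℕ} (hu : u < S.size s) (v : Fin (S.n s)) :
    S.digit s (u + S.size s * v) = v := by
  ext
  simp only [digit]
  rw [Nat.add_mul_div_left _ _ (S.size_pos s), Nat.div_eq_of_lt hu, zero_add,
    Nat.mod_eq_of_lt v.2]

end SignSystem

lemma sum_range_mul_eq {E : Type*} [AddCommMonoid E] (F : ℕ → E) (a b : ℕ) :
    ∑ t ∈ Finset.range (a * b), F t = ∑ v : Fin b, ∑ u ∈ Finset.range a, F (u + a * v) := by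
  rw [Fin.sum_univ_eq_sum_range (fun v => ∑ u ∈ Finset.range a, F (u + a * v)) b]
  induction b with
  | zero => simp
  | succ b ih =>
    rw [Nat.mul_succ, Finset.sum_range_add, ih, Finset.sum_range_succ]
    simp only [add_comm]

namespace SignSystem

variable (S : SignSystem) {𝕜 : Type*} [RCLike 𝕜]

/-- The average of a function over the product of the first `s` levels. -/
noncomputable def avg (s : ℕ) (f : ℕ → 𝕜) : 𝕜 :=
  (∑ t ∈ Finset.range (S.size s), f t) / (S.size s : 𝕜)

lemma size_ne_zero (s : ℕ) : (S.size s : 𝕜) ≠ 0 := Nat.cast_ne_zero.2 (S.size_pos s).ne'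

lemma n_ne_zero (s : ℕ) : (S.n s : 𝕜) ≠ 0 := Nat.cast_ne_zero.2 (S.n_pos s).ne'

lemma avg_succ (s : ℕ) (f : ℕ → 𝕜) (g : Fin (S.n s) → 𝕜)
    (hf : ∀ u v, f (u + S.size s * v) = f u) :
    S.avg (s + 1) (fun t => f t * g (S.digit s t)) = S.avg s f * ((∑ a, g a) / S.n s) := by
  have h : ∀ v : Fin (S.n s), ∑ u ∈ Finset.range (S.size s),
      f (u + S.size s * v) * g (S.digit s (u + S.size s * v)) =
        (∑ u ∈ Finset.range (S.size s), f u) * g v := by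
    intro v
    rw [Finset.sum_mul]
    refine Finset.sum_congr rfl fun u hu => ?_
    rw [hf, S.digit_add_self (Finset.mem_range.1 hu)]
  simp only [avg]
  rw [S.size_succ, sum_range_mul_eq, Finset.sum_congr rfl fun v _ => h v, ← Finset.mul_sum]
  have := S.size_ne_zero (𝕜 := 𝕜) s
  have := S.n_ne_zero (𝕜 := 𝕜) s
  push_cast
  field_simp

lemma avg_eq_of_le {i s : ℕ} (h : i ≤ s) (f : ℕ → 𝕜)
    (hf : ∀ r, i ≤ r → ∀ u v, f (u + S.size r * v) = f u) : S.avg s f = S.avg i f := by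
  induction s, h using Nat.le_induction with
  | base => rfl
  | succ s hs ih =>
    have := S.avg_succ s f 1 (hf s hs)
    simpa [ih, div_self (S.n_ne_zero (𝕜 := 𝕜) s)] using this

lemma avg_digit {i s : ℕ} (h : i < s) (f : Fin (S.n i) → 𝕜) :
    S.avg s (fun t => f (S.digit i t)) = (∑ a, f a) / S.n i := by
  rw [S.avg_eq_of_le (Nat.succ_le_of_lt h)]
  · have := S.avg_succ i 1 f (fun _ _ => rfl)
    have h1 : S.avg i (1 : ℕ → 𝕜) = 1 := by
      simp [avg, div_self (S.size_ne_zero (𝕜 := 𝕜) i)]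
    simpa [h1] using this
  · intro r hr u v
    rw [S.digit_add_of_lt (by omega)]

lemma avg_digit_mul_digit {i j s : ℕ} (hij : i < j) (h : j < s) (f : Fin (S.n i) → 𝕜)
    (g : Fin (S.n j) → 𝕜) :
    S.avg s (fun t => f (S.digit i t) * g (S.digit j t)) =
      ((∑ a, f a) / S.n i) * ((∑ a, g a) / S.n j) := by
  rw [S.avg_eq_of_le (Nat.succ_le_of_lt h)]
  · have := S.avg_succ j (fun t => f (S.digit i t)) g
      (fun u v => by rw [S.digit_add_of_lt hij])
    rw [this, S.avg_digit hij]
  · intro r hr u v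
    rw [S.digit_add_of_lt (by omega), S.digit_add_of_lt (by omega)]

lemma avg_add (s : ℕ) (f g : ℕ → 𝕜) : S.avg s (f + g) = S.avg s f + S.avg s g := by
  simp [avg, Finset.sum_add_distrib, add_div]

lemma avg_const_mul (s : ℕ) (c : 𝕜) (f : ℕ → 𝕜) :
    S.avg s (fun t => c * f t) = c * S.avg s f := by
  simp [avg, ← Finset.mul_sum, mul_div_assoc]

lemma norm_avg_le_avg_norm (s : ℕ) (f : ℕ → 𝕜) :
    ‖S.avg s f‖ ≤ S.avg s (fun t => ‖f t‖) := by
  simp only [avg, norm_div, RCLike.norm_natCast]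
  gcongr
  exact norm_sum_le _ _

lemma avg_mono (s : ℕ) {f g : ℕ → ℝ} (h : ∀ t, f t ≤ g t) : S.avg s f ≤ S.avg s g := by
  simp only [avg]
  gcongr
  exact h _

lemma norm_avg_le (s : ℕ) {f : ℕ → 𝕜} {C : ℝ} (h : ∀ t, ‖f t‖ ≤ C) : ‖S.avg s f‖ ≤ C := by
  refine (S.norm_avg_le_avg_norm s f).trans ((S.avg_mono s h).trans ?_)
  simp [avg, mul_div_cancel_left₀ C (S.size_ne_zero (𝕜 := ℝ) s)]

/-- The limit of the averages along a nonprincipal ultrafilter. -/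
noncomputable def mean (f : ℕ → 𝕜) : 𝕜 :=
  Filter.limUnder (Filter.hyperfilter ℕ : Filter ℕ) fun s => S.avg s f

lemma tendsto_mean {f : ℕ → 𝕜} {C : ℝ} (h : ∀ t, ‖f t‖ ≤ C) :
    Filter.Tendsto (fun s => S.avg s f) (Filter.hyperfilter ℕ) (nhds (S.mean f)) := by
  apply tendsto_nhds_limUnder
  have hc : IsCompact (Metric.closedBall (0 : 𝕜) C) := isCompact_closedBall 0 C
  obtain ⟨x, -, hx⟩ := hc.ultrafilter_le_nhds ((Filter.hyperfilter ℕ).map fun s => S.avg s f)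
    (Filter.le_principal_iff.2 <| Filter.mem_map.2 <| Filter.univ_mem' fun s => by
      simpa using S.norm_avg_le s h)
  exact ⟨x, hx⟩

lemma eventually_hyperfilter_gt (i : ℕ) : ∀ᶠ s in (Filter.hyperfilter ℕ : Filter ℕ), i < s :=
  (Nat.hyperfilter_le_atTop) (Filter.eventually_gt_atTop i)

lemma norm_mean_le {f : ℕ → 𝕜} {C : ℝ} (h : ∀ t, ‖f t‖ ≤ C) : ‖S.mean f‖ ≤ C :=
  le_of_tendsto (S.tendsto_mean h).norm (Filter.Eventually.of_forall fun s => S.norm_avg_le s h)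

lemma norm_mean_le_mean_norm {f : ℕ → 𝕜} {C : ℝ} (h : ∀ t, ‖f t‖ ≤ C) :
    ‖S.mean f‖ ≤ S.mean (fun t => ‖f t‖) :=
  le_of_tendsto_of_tendsto' (S.tendsto_mean h).norm
    (S.tendsto_mean (f := fun t => ‖f t‖) (C := C) (by simpa using h))
    (fun s => S.norm_avg_le_avg_norm s f)

lemma mean_mono {f g : ℕ → ℝ} {C D : ℝ} (hf : ∀ t, ‖f t‖ ≤ C) (hg : ∀ t, ‖g t‖ ≤ D)
    (h : ∀ t, f t ≤ g t) : S.mean f ≤ S.mean g :=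
  le_of_tendsto_of_tendsto' (S.tendsto_mean hf) (S.tendsto_mean hg) fun s => S.avg_mono s h

lemma mean_add {f g : ℕ → 𝕜} {C D : ℝ} (hf : ∀ t, ‖f t‖ ≤ C) (hg : ∀ t, ‖g t‖ ≤ D) :
    S.mean (f + g) = S.mean f + S.mean g := by
  refine tendsto_nhds_unique (S.tendsto_mean (C := C + D) fun t => ?_) ?_
  · exact (norm_add_le _ _).trans (add_le_add (hf t) (hg t))
  · simp only [avg_add]
    exact (S.tendsto_mean hf).add (S.tendsto_mean hg)

lemma mean_const_mul {f : ℕ → 𝕜} {C : ℝ} (c : 𝕜) (hf : ∀ t, ‖f t‖ ≤ C) :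
    S.mean (fun t => c * f t) = c * S.mean f := by
  refine tendsto_nhds_unique (S.tendsto_mean (C := ‖c‖ * C) fun t => ?_) ?_
  · rw [norm_mul]; gcongr; exact hf t
  · simp only [avg_const_mul]
    exact (S.tendsto_mean hf).const_mul c

lemma mean_sum {ι : Type*} (A : Finset ι) {f : ι → ℕ → 𝕜} {C : ℝ}
    (hf : ∀ a t, ‖f a t‖ ≤ C) : S.mean (fun t => ∑ a ∈ A, f a t) = ∑ a ∈ A, S.mean (f a) := by
  refine tendsto_nhds_unique (S.tendsto_mean (C := A.card * C) fun t => ?_) ?_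
  · refine (norm_sum_le _ _).trans ((Finset.sum_le_sum fun a _ => hf a t).trans ?_)
    simp
  · have : ∀ s, S.avg s (fun t => ∑ a ∈ A, f a t) = ∑ a ∈ A, S.avg s (f a) := by
      intro s
      simp only [avg, ← Finset.sum_div]
      rw [Finset.sum_comm]
    simp only [this]
    exact tendsto_finsetSum A fun a _ => S.tendsto_mean (hf a)

lemma mean_digit {i : ℕ} (f : Fin (S.n i) → 𝕜) :
    S.mean (fun t => f (S.digit i t)) = (∑ a, f a) / S.n i := by
  refine tendsto_nhds_unique (S.tendsto_mean (C := ∑ a, ‖f a‖) fun t => ?_) ?_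
  · exact Finset.single_le_sum (f := fun a => ‖f a‖) (fun a _ => norm_nonneg _)
      (Finset.mem_univ _)
  · refine tendsto_const_nhds.congr' ?_
    filter_upwards [eventually_hyperfilter_gt i] with s hs
    rw [S.avg_digit hs]

end SignSystem

/-- Bessel's inequality for a finite family of almost orthonormal vectors. -/
lemma sum_norm_inner_sq_le {𝕜 H ι : Type*} [RCLike 𝕜] [NormedAddCommGroup H]
    [InnerProductSpace 𝕜 H] (A : Finset ι) (v : ι → H) {c δ : ℝ} (hc : 0 ≤ c) (hδ : 0 ≤ δ)
    (hv : ∀ i ∈ A, ‖v i‖ ^ 2 ≤ c) (hvv : ∀ i ∈ A, ∀ j ∈ A, i ≠ j → ‖inner 𝕜 (v i) (v j)‖ ≤ δ)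
    (x : H) : ∑ i ∈ A, ‖inner 𝕜 (v i) x‖ ^ 2 ≤ (c + A.card * δ) * ‖x‖ ^ 2 := by
  classical
  set a : ι → 𝕜 := fun i => inner 𝕜 (v i) x with ha
  set T : ℝ := ∑ i ∈ A, ‖a i‖ ^ 2 with hT
  have hT0 : 0 ≤ T := Finset.sum_nonneg fun i _ => by positivity
  set z : H := ∑ i ∈ A, a i • v i with hz
  have h1 : inner 𝕜 z x = (T : 𝕜) := by
    rw [hz, sum_inner, hT]
    push_cast
    refine Finset.sum_congr rfl fun i _ => ?_
    rw [inner_smul_left, RCLike.conj_mul]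
  have h2 : ‖z‖ ^ 2 ≤ (c + A.card * δ) * T := by
    have h3 : ‖z‖ ^ 2 ≤ ∑ i ∈ A, ∑ j ∈ A, ‖a i‖ * ‖a j‖ * ‖inner 𝕜 (v i) (v j)‖ := by
      have : ((‖z‖ ^ 2 : ℝ) : 𝕜) = inner 𝕜 z z := by
        rw [inner_self_eq_norm_sq_to_K]; push_cast; rfl
      have h4 : ‖z‖ ^ 2 = ‖inner 𝕜 z z‖ := by
        rw [← this, RCLike.norm_ofReal, abs_of_nonneg (by positivity)]
      rw [h4]
      nth_rw 1 [hz]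
      rw [sum_inner]
      refine (norm_sum_le _ _).trans (Finset.sum_le_sum fun i _ => ?_)
      rw [hz, inner_sum]
      refine (norm_sum_le _ _).trans (Finset.sum_le_sum fun j _ => ?_)
      rw [inner_smul_left, inner_smul_right, norm_mul, norm_mul, RCLike.norm_conj, mul_assoc]
    have h5 : ∀ i ∈ A, ∀ j ∈ A, ‖a i‖ * ‖a j‖ * ‖inner 𝕜 (v i) (v j)‖ ≤
        (if i = j then c * ‖a i‖ ^ 2 else 0) + δ * (‖a i‖ * ‖a j‖) := by
      intro i hi j hj
      split_ifs with hij
      · subst hij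
        have : ‖inner 𝕜 (v i) (v i)‖ ≤ c := by
          rw [inner_self_eq_norm_sq_to_K]
          simpa using hv i hi
        nlinarith [mul_nonneg hδ (mul_self_nonneg ‖a i‖), mul_self_nonneg ‖a i‖]
      · have := hvv i hi j hj hij
        nlinarith [mul_nonneg (norm_nonneg (a i)) (norm_nonneg (a j))]
    refine h3.trans ((Finset.sum_le_sum fun i hi => Finset.sum_le_sum fun j hj =>
      h5 i hi j hj).trans ?_)
    simp only [Finset.sum_add_distrib]
    have h6 : ∑ i ∈ A, ∑ j ∈ A, (if i = j then c * ‖a i‖ ^ 2 else 0) = c * T := by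
      rw [hT, Finset.mul_sum]
      refine Finset.sum_congr rfl fun i hi => ?_
      simp [hi]
    have h7 : ∑ i ∈ A, ∑ j ∈ A, δ * (‖a i‖ * ‖a j‖) = δ * (∑ i ∈ A, ‖a i‖) ^ 2 := by
      simp only [← Finset.mul_sum, sq, Finset.sum_mul_sum]
    have h8 : (∑ i ∈ A, ‖a i‖) ^ 2 ≤ A.card * T := sq_sum_le_card_mul_sum_sq
    rw [h6, h7]
    nlinarith [mul_le_mul_of_nonneg_left h8 hδ]
  have h9 : T ≤ ‖z‖ * ‖x‖ := by
    have := norm_inner_le_norm (𝕜 := 𝕜) z x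
    rwa [h1, RCLike.norm_ofReal, abs_of_nonneg hT0] at this
  change T ≤ _
  by_cases hT1 : T = 0
  · rw [hT1]
    positivity
  · have hTpos : 0 < T := lt_of_le_of_ne hT0 (Ne.symm hT1)
    have : T * T ≤ ((c + A.card * δ) * ‖x‖ ^ 2) * T := by
      calc T * T ≤ (‖z‖ * ‖x‖) * (‖z‖ * ‖x‖) := mul_le_mul h9 h9 hT0 (by positivity)
        _ = ‖z‖ ^ 2 * ‖x‖ ^ 2 := by ring
        _ ≤ ((c + A.card * δ) * T) * ‖x‖ ^ 2 := by gcongr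
        _ = _ := by ring
    exact le_of_mul_le_mul_right this hTpos

namespace EllInfty

variable {𝕜 : Type} [RCLike 𝕜]

/-- The coordinate functionals on `ℓ_∞`. -/
noncomputable def coord (t : ℕ) : EllInfty 𝕜 →ₗ[𝕜] 𝕜 where
  toFun x := (show lp (fun _ : ℕ => 𝕜) ∞ from x) t
  map_add' _ _ := rfl
  map_smul' _ _ := rfl

lemma norm_coord_le (t : ℕ) (x : EllInfty 𝕜) : ‖coord t x‖ ≤ ‖x‖ :=
  lp.norm_apply_le_norm ENNReal.top_ne_zero (show lp (fun _ : ℕ => 𝕜) ∞ from x) t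

lemma norm_le_of_forall {x : EllInfty 𝕜} {C : ℝ} (hC : 0 ≤ C) (h : ∀ t, ‖coord t x‖ ≤ C) :
    ‖x‖ ≤ C :=
  lp.norm_le_of_forall_le (f := (show lp (fun _ : ℕ => 𝕜) ∞ from x)) hC h

lemma exists_lt_norm_coord {x : EllInfty 𝕜} {C : ℝ} (hC : 0 ≤ C) (h : C < ‖x‖) :
    ∃ t, C < ‖coord t x‖ := by
  by_contra! hx
  exact absurd (norm_le_of_forall hC hx) (not_le.2 h)

lemma ext_coord {x y : EllInfty 𝕜} (h : ∀ t, coord t x = coord t y) : x = y :=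
  lp.ext (E := fun _ : ℕ => 𝕜) (p := ∞) (funext h)

/-- The element of `ℓ_∞` with given coordinates. -/
noncomputable def ofBounded (f : ℕ → 𝕜) {C : ℝ} (hf : ∀ t, ‖f t‖ ≤ C) : EllInfty 𝕜 :=
  (⟨f, memℓp_infty ⟨C, by rintro _ ⟨t, rfl⟩; exact hf t⟩⟩ : lp (fun _ : ℕ => 𝕜) ∞)

@[simp]
lemma coord_ofBounded (f : ℕ → 𝕜) {C : ℝ} (hf : ∀ t, ‖f t‖ ≤ C) (t : ℕ) :
    coord t (ofBounded f hf) = f t := rfl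

/-- The rows of a contraction into `ℓ_∞` are bounded by one in the `ℓ_1` norm. -/
lemma sum_norm_coord_le {ι : Type*} [Fintype ι] [DecidableEq ι] (B : (ι → 𝕜) →L[𝕜] EllInfty 𝕜)
    (hB : ‖B‖ ≤ 1) (t : ℕ) : ∑ a, ‖coord t (B (Pi.single a 1))‖ ≤ 1 := by
  choose c hc hc' using fun a => RCLike.exists_norm_eq_mul_self (coord t (B (Pi.single a 1)))
  have h1 : coord t (B c) = ((∑ a, ‖coord t (B (Pi.single a 1))‖ : ℝ) : 𝕜) := by
    conv_lhs => rw [pi_eq_sum_univ' c]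
    simp only [map_sum, map_smul, smul_eq_mul, hc']
  have h2 : ‖coord t (B c)‖ ≤ 1 := by
    refine (norm_coord_le t _).trans ((B.le_opNorm c).trans ?_)
    have : ‖c‖ ≤ 1 := (pi_norm_le_iff_of_nonneg zero_le_one).2 fun a => (hc a).le
    exact mul_le_one₀ hB (norm_nonneg _) this
  rw [h1, RCLike.norm_ofReal, abs_of_nonneg (Finset.sum_nonneg fun a _ => norm_nonneg _)] at h2
  exact h2

end EllInfty

namespace SignSystem

variable (S : SignSystem) {𝕜 : Type} [RCLike 𝕜]

/-- The index set of all sign functions of all levels. -/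
abbrev Index : Type := Σ i, Fin (S.N i)

/-- The sign function `h`, as a function of the corresponding digit. -/
noncomputable def osc (h : S.Index) (t : ℕ) : 𝕜 := (S.sgn h.1 h.2 (S.digit h.1 t) : 𝕜)

lemma norm_sgn (i : ℕ) (k : Fin (S.N i)) (a : Fin (S.n i)) : ‖(S.sgn i k a : 𝕜)‖ = 1 := by
  rw [RCLike.norm_ofReal, S.abs_sgn]

lemma norm_osc (h : S.Index) (t : ℕ) : ‖(S.osc h t : 𝕜)‖ = 1 := S.norm_sgn _ _ _

lemma norm_sum_ofReal_div_le {i : ℕ} {f : Fin (S.n i) → ℝ} (hf : S.R i * |∑ a, f a| ≤ S.n i) :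
    ‖(∑ a, (f a : 𝕜)) / (S.n i : 𝕜)‖ ≤ (S.R i : ℝ)⁻¹ := by
  have hR : (0 : ℝ) < S.R i := by exact_mod_cast S.R_pos i
  have hn : (0 : ℝ) < S.n i := by exact_mod_cast S.n_pos i
  rw [← RCLike.ofReal_sum, norm_div, RCLike.norm_ofReal, RCLike.norm_natCast, div_le_iff₀ hn,
    le_inv_mul_iff₀ hR]
  exact hf

lemma norm_avg_osc_mul_osc_le_of_lt {h h' : S.Index} (hlt : h.1 < h'.1) {s : ℕ} (hs : h'.1 < s) :
    ‖S.avg s (fun t => (S.osc h t : 𝕜) * S.osc h' t)‖ ≤ (S.R h'.1 : ℝ)⁻¹ := by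
  have := S.avg_digit_mul_digit hlt hs (fun a => (S.sgn h.1 h.2 a : 𝕜))
    (fun a => (S.sgn h'.1 h'.2 a : 𝕜))
  simp only [osc]
  rw [this, norm_mul]
  have h1 : ‖(∑ a, (S.sgn h.1 h.2 a : 𝕜)) / (S.n h.1 : 𝕜)‖ ≤ 1 := by
    refine (S.norm_sum_ofReal_div_le (S.mean_le _ _)).trans (inv_le_one_of_one_le₀ ?_)
    exact_mod_cast S.R_pos h.1
  have h2 := S.norm_sum_ofReal_div_le (𝕜 := 𝕜) (S.mean_le h'.1 h'.2)
  calc _ ≤ 1 * (S.R h'.1 : ℝ)⁻¹ := mul_le_mul h1 h2 (norm_nonneg _) zero_le_one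
    _ = _ := one_mul _

lemma norm_avg_osc_mul_osc_le {h h' : S.Index} (hne : h ≠ h') {i s : ℕ} (hi : i ≤ h.1)
    (hi' : i ≤ h'.1) (hs : h.1 < s) (hs' : h'.1 < s) :
    ‖S.avg s (fun t => (S.osc h t : 𝕜) * S.osc h' t)‖ ≤ (S.R i : ℝ)⁻¹ := by
  have hmono : ∀ j, i ≤ j → (S.R j : ℝ)⁻¹ ≤ (S.R i : ℝ)⁻¹ := fun j hj => by
    have := S.R_pos i
    gcongr
    exact S.R_strictMono.monotone hj
  rcases lt_trichotomy h.1 h'.1 with hlt | heq | hgt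
  · exact (S.norm_avg_osc_mul_osc_le_of_lt hlt hs').trans (hmono _ hi')
  · obtain ⟨j, k⟩ := h
    obtain ⟨j', k'⟩ := h'
    obtain rfl : j = j' := heq
    have hk : k ≠ k' := fun hk => hne (by rw [hk])
    have := S.avg_digit hs (fun a => ((S.sgn j k a * S.sgn j k' a : ℝ) : 𝕜))
    simp only [osc, ← RCLike.ofReal_mul]
    rw [this]
    exact (S.norm_sum_ofReal_div_le (S.corr_le j k k' hk)).trans (hmono _ hi)
  · simp only [mul_comm (S.osc h _)]
    exact (S.norm_avg_osc_mul_osc_le_of_lt hgt hs).trans (hmono _ hi)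

lemma sum_norm_avg_osc_sq_le (A : Finset S.Index) {i s : ℕ} (hi : ∀ h ∈ A, i ≤ h.1)
    (hs : ∀ h ∈ A, h.1 < s) (f : ℕ → 𝕜) :
    ∑ h ∈ A, ‖S.avg s (fun t => S.osc h t * f t)‖ ^ 2 ≤
      (1 + A.card * (S.R i : ℝ)⁻¹) * S.avg s (fun t => ‖f t‖ ^ 2) := by
  set P := S.size s with hP
  have hPpos : (0 : ℝ) < P := by exact_mod_cast S.size_pos s
  let v : S.Index → EuclideanSpace 𝕜 (Fin P) := fun h => WithLp.toLp 2 fun t => S.osc h t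
  let x : EuclideanSpace 𝕜 (Fin P) := WithLp.toLp 2 fun t => f t
  have hin : ∀ h (g : ℕ → 𝕜), inner 𝕜 (v h) (WithLp.toLp 2 fun t : Fin P => g t) =
      P * S.avg s (fun t => S.osc h t * g t) := by
    intro h g
    rw [avg, mul_div_cancel₀ _ (S.size_ne_zero s), PiLp.inner_apply]
    rw [← Fin.sum_univ_eq_sum_range (fun t => S.osc h t * g t)]
    refine Finset.sum_congr rfl fun t _ => ?_
    simp [v, osc, mul_comm]
  have hnorm : ∀ h, ‖v h‖ ^ 2 = P := by
    intro h
    rw [EuclideanSpace.norm_sq_eq]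
    simp [v, S.norm_osc]
  have hx : ‖x‖ ^ 2 = P * S.avg s (fun t => ‖f t‖ ^ 2) := by
    rw [EuclideanSpace.norm_sq_eq, avg]
    simp only [x]
    rw [Fin.sum_univ_eq_sum_range (fun t => ‖f t‖ ^ 2)]
    exact (mul_div_cancel₀ _ hPpos.ne').symm
  have key := sum_norm_inner_sq_le (𝕜 := 𝕜) A v (c := P) (δ := P * (S.R i : ℝ)⁻¹) (by positivity)
    (by positivity) (fun h _ => (hnorm h).le) (fun h hh h' hh' hne => by
      rw [hin, norm_mul, RCLike.norm_natCast]
      gcongr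
      exact S.norm_avg_osc_mul_osc_le hne (hi h hh) (hi h' hh') (hs h hh) (hs h' hh')) x
  rw [hx] at key
  simp only [x, hin, norm_mul, RCLike.norm_natCast, mul_pow, ← Finset.mul_sum] at key
  have : (P : ℝ) ^ 2 * ∑ h ∈ A, ‖S.avg s (fun t => S.osc h t * f t)‖ ^ 2 ≤
      (P : ℝ) ^ 2 * ((1 + A.card * (S.R i : ℝ)⁻¹) * S.avg s (fun t => ‖f t‖ ^ 2)) := by
    refine key.trans (le_of_eq ?_)
    ring
  exact le_of_mul_le_mul_left this (by positivity)

lemma sum_norm_mean_osc_sq_le (A : Finset S.Index) {i : ℕ} (hi : ∀ h ∈ A, i ≤ h.1) {f : ℕ → 𝕜}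
    {C : ℝ} (hf : ∀ t, ‖f t‖ ≤ C) :
    ∑ h ∈ A, ‖S.mean (fun t => S.osc h t * f t)‖ ^ 2 ≤
      (1 + A.card * (S.R i : ℝ)⁻¹) * S.mean (fun t => ‖f t‖ ^ 2) := by
  refine le_of_tendsto_of_tendsto (tendsto_finsetSum A fun h _ =>
    ((S.tendsto_mean (f := fun t => S.osc h t * f t) (C := C) fun t => ?_).norm.pow 2))
    ((S.tendsto_mean (f := fun t => ‖f t‖ ^ 2) (C := C ^ 2) fun t => ?_).const_mul _) ?_
  · simpa [S.norm_osc] using hf t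
  · have := hf t
    rw [norm_pow, norm_norm]
    gcongr
  · filter_upwards [eventually_hyperfilter_gt (A.sup fun h => h.1)] with s hs
    exact S.sum_norm_avg_osc_sq_le A hi
      (fun h hh => lt_of_le_of_lt (Finset.le_sup (f := fun h : S.Index => h.1) hh) hs) f

/-- A bounded function has large correlation with few sign functions of a given level. -/
lemma card_mul_sq_le {i : ℕ} (A : Finset (Fin (S.N i))) {g : Fin (S.n i) → 𝕜} {C ε : ℝ}
    (hε : 0 ≤ ε) (hg : ∀ a, ‖g a‖ ≤ C)
    (hA : ∀ k ∈ A, ε ≤ ‖(∑ a, g a * (S.sgn i k a : 𝕜)) / (S.n i : 𝕜)‖) :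
    A.card * ε ^ 2 ≤ (1 + A.card * (S.R i : ℝ)⁻¹) * C ^ 2 := by
  have hnpos : (0 : ℝ) < S.n i := by exact_mod_cast S.n_pos i
  let v : Fin (S.N i) → EuclideanSpace 𝕜 (Fin (S.n i)) := fun k => 
    WithLp.toLp 2 fun a => (S.sgn i k a : 𝕜)
  let x : EuclideanSpace 𝕜 (Fin (S.n i)) := WithLp.toLp 2 g
  have hin : ∀ k (g : Fin (S.n i) → 𝕜), inner 𝕜 (v k) (WithLp.toLp 2 g) =
      S.n i * ((∑ a, g a * (S.sgn i k a : 𝕜)) / (S.n i : 𝕜)) := by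
    intro k g
    rw [mul_div_cancel₀ _ (S.n_ne_zero i), PiLp.inner_apply]
    refine Finset.sum_congr rfl fun t _ => ?_
    simp [v]
  have hnorm : ∀ k, ‖v k‖ ^ 2 = S.n i := by
    intro k
    rw [EuclideanSpace.norm_sq_eq]
    simp [v, S.abs_sgn]
  have hx : ‖x‖ ^ 2 ≤ S.n i * C ^ 2 := by
    rw [EuclideanSpace.norm_sq_eq]
    refine (Finset.sum_le_sum (g := fun _ => C ^ 2) fun a _ => ?_).trans ?_
    · have := hg a
      simp only [x]
      gcongr
    · simp
  have key := sum_norm_inner_sq_le (𝕜 := 𝕜) A v (c := S.n i) (δ := S.n i * (S.R i : ℝ)⁻¹) (by positivity)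
    (by positivity) (fun h _ => (hnorm h).le) (fun k _ l _ hne => by
      simp only [v]
      rw [hin, norm_mul, RCLike.norm_natCast]
      gcongr
      simp only [← RCLike.ofReal_mul]
      exact S.norm_sum_ofReal_div_le (S.corr_le i l k hne.symm)) x
  simp only [x, hin, norm_mul, RCLike.norm_natCast, mul_pow, ← Finset.mul_sum] at key
  have h1 : (A.card : ℝ) * ε ^ 2 ≤
      ∑ k ∈ A, ‖(∑ a, g a * (S.sgn i k a : 𝕜)) / (S.n i : 𝕜)‖ ^ 2 := by
    rw [← nsmul_eq_mul]
    refine Finset.card_nsmul_le_sum _ _ _ fun k hk => ?_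
    have := hA k hk
    gcongr
  have : (S.n i : ℝ) ^ 2 * (A.card * ε ^ 2) ≤
      (S.n i : ℝ) ^ 2 * ((1 + A.card * (S.R i : ℝ)⁻¹) * C ^ 2) := by
    refine (mul_le_mul_of_nonneg_left h1 (by positivity)).trans (key.trans ?_)
    calc _ ≤ ((S.n i : ℝ) + A.card * (S.n i * (S.R i : ℝ)⁻¹)) * (S.n i * C ^ 2) := by gcongr
      _ = _ := by ring
  exact le_of_mul_le_mul_left this (by positivity)

open Classical in
/-- The kernel of the operator attached to a set `L` of levels: its `r`-th row is the sign function
with code `r` if the level of that function belongs to `L`, and zero otherwise. -/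
noncomputable def kernel (L : Set ℕ) (r t : ℕ) : 𝕜 :=
  match (Encodable.decode r : Option S.Index) with
  | some h => if h.1 ∈ L then S.osc h t else 0
  | none => 0

lemma kernel_encode {L : Set ℕ} {h : S.Index} (hh : h.1 ∈ L) (t : ℕ) :
    (S.kernel L (Encodable.encode h) t : 𝕜) = S.osc h t := by
  simp [kernel, hh]

lemma kernel_eq (L : Set ℕ) (r : ℕ) :
    (∃ h : S.Index, h.1 ∈ L ∧ ∀ t, (S.kernel L r t : 𝕜) = S.osc h t) ∨
      ∀ t, (S.kernel L r t : 𝕜) = 0 := by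
  rcases hr : (Encodable.decode r : Option S.Index) with _ | h
  · right; intro t; simp [kernel, hr]
  · by_cases hh : h.1 ∈ L
    · left; exact ⟨h, hh, fun t => by simp [kernel, hr, hh]⟩
    · right; intro t; simp [kernel, hr, hh]

lemma norm_kernel_le (L : Set ℕ) (r t : ℕ) : ‖(S.kernel L r t : 𝕜)‖ ≤ 1 := by
  rcases S.kernel_eq (𝕜 := 𝕜) L r with ⟨h, -, hr⟩ | hr
  · rw [hr, S.norm_osc]
  · rw [hr, norm_zero]; exact zero_le_one

lemma norm_kernel_mul_coord_le (L : Set ℕ) (r : ℕ) (x : EllInfty 𝕜) (t : ℕ) :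
    ‖S.kernel L r t * EllInfty.coord t x‖ ≤ ‖x‖ := by
  rw [norm_mul]
  calc _ ≤ 1 * ‖x‖ := mul_le_mul (S.norm_kernel_le L r t) (EllInfty.norm_coord_le t x)
        (norm_nonneg _) zero_le_one
    _ = _ := one_mul _

/-- The operator on `ℓ_∞` which maps `x` to its correlations with the sign functions whose level
belongs to `L`. -/
noncomputable def op (L : Set ℕ) : EllInfty 𝕜 →L[𝕜] EllInfty 𝕜 :=
  LinearMap.mkContinuous
    { toFun := fun x => EllInfty.ofBounded
        (fun r => S.mean fun t => S.kernel L r t * EllInfty.coord t x)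
        (fun r => S.norm_mean_le (S.norm_kernel_mul_coord_le L r x))
      map_add' := fun x y => EllInfty.ext_coord fun r => by
        simp only [EllInfty.coord_ofBounded, map_add, mul_add]
        exact S.mean_add (S.norm_kernel_mul_coord_le L r x) (S.norm_kernel_mul_coord_le L r y)
      map_smul' := fun c x => EllInfty.ext_coord fun r => by
        simp only [EllInfty.coord_ofBounded, map_smul, smul_eq_mul, mul_left_comm _ c,
          RingHom.id_apply]
        exact S.mean_const_mul c (S.norm_kernel_mul_coord_le L r x) }
    1 (fun x => by
      rw [one_mul]
      exact EllInfty.norm_le_of_forall (norm_nonneg _) fun r =>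
        S.norm_mean_le (S.norm_kernel_mul_coord_le L r x))

lemma coord_op (L : Set ℕ) (r : ℕ) (x : EllInfty 𝕜) :
    EllInfty.coord r (S.op L x) = S.mean fun t => S.kernel L r t * EllInfty.coord t x := rfl

lemma exists_lt_norm_mean_of_lt_norm_op {L : Set ℕ} {x : EllInfty 𝕜} {ε : ℝ} (hε : 0 ≤ ε)
    (hx : ε < ‖S.op L x‖) :
    ∃ h : S.Index, h.1 ∈ L ∧ ε < ‖S.mean fun t => S.osc h t * EllInfty.coord t x‖ := by
  obtain ⟨r, hr⟩ := EllInfty.exists_lt_norm_coord hε hx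
  rw [coord_op] at hr
  rcases S.kernel_eq (𝕜 := 𝕜) L r with ⟨h, hh, hk⟩ | hk
  · exact ⟨h, hh, by simpa only [hk] using hr⟩
  · have : S.mean (fun _ : ℕ => (0 : 𝕜)) = 0 := by
      have := S.norm_mean_le (f := fun _ : ℕ => (0 : 𝕜)) (C := 0) (by simp)
      simpa using this
    simp only [hk, zero_mul, this, norm_zero] at hr
    exact absurd hr (not_lt.2 hε)

lemma norm_mean_osc_mul_le_norm_op {L : Set ℕ} {h : S.Index} (hh : h.1 ∈ L) (x : EllInfty 𝕜) :
    ‖S.mean fun t => S.osc h t * EllInfty.coord t x‖ ≤ ‖S.op L x‖ := by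
  have := EllInfty.norm_coord_le (Encodable.encode h) (S.op L x)
  rw [coord_op] at this
  simpa only [S.kernel_encode hh] using this

/-- The restriction of a sign function to a set of points. -/
noncomputable def cut (𝕜 : Type) [RCLike 𝕜] (i : ℕ) (k : Fin (S.N i)) (W : Finset (Fin (S.n i)))
    (a : Fin (S.n i)) : 𝕜 :=
  if a ∈ W then (S.sgn i k a : 𝕜) else 0

end SignSystem

namespace SignSystem

variable (S : SignSystem) {𝕜 : Type} [RCLike 𝕜]

/-- At level `i`, up to `ε`, the operator `T` kills most restricted sign functions, whatever
contraction is used to map them into `ℓ_∞`. -/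
def SmallAt (T : EllInfty 𝕜 →L[𝕜] EllInfty 𝕜) (ε : ℝ) (i : ℕ) : Prop :=
  ∀ B : (Fin (S.n i) → 𝕜) →L[𝕜] EllInfty 𝕜, ‖B‖ ≤ 1 →
    ∃ W : Finset (Fin (S.n i)), (Wᶜ.card : ℝ) ≤ ε * S.n i ∧ ∀ W' ⊆ W,
      ∀ A : Finset (Fin (S.N i)), (∀ k ∈ A, ε < ‖T (B (S.cut 𝕜 i k W'))‖) → (A.card : ℝ) ≤ ε * S.N i

section

variable {i : ℕ} (B : (Fin (S.n i) → 𝕜) →L[𝕜] EllInfty 𝕜)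

/-- The `a`-th column of an operator into `ℓ_∞`. -/
noncomputable def column (a : Fin (S.n i)) (t : ℕ) : 𝕜 := EllInfty.coord t (B (Pi.single a 1))

/-- The mean absolute value of the `a`-th column of an operator into `ℓ_∞`. -/
noncomputable def mass (a : Fin (S.n i)) : ℝ := S.mean fun t => ‖S.column B a t‖

variable {B}

lemma norm_column_le (hB : ‖B‖ ≤ 1) (a : Fin (S.n i)) (t : ℕ) : ‖S.column B a t‖ ≤ 1 :=
  (Finset.single_le_sum (f := fun a => ‖S.column B a t‖) (fun _ _ => norm_nonneg _)
    (Finset.mem_univ a)).trans (EllInfty.sum_norm_coord_le B hB t)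

lemma norm_mean_osc_column_le (hB : ‖B‖ ≤ 1) (h : S.Index) (a : Fin (S.n i)) :
    ‖S.mean fun t => S.osc h t * S.column B a t‖ ≤ S.mass B a := by
  have := S.norm_mean_le_mean_norm (f := fun t => S.osc h t * S.column B a t) (C := 1) fun t => by
    simpa [S.norm_osc] using S.norm_column_le hB a t
  simpa [S.norm_osc, mass] using this

lemma mass_nonneg (hB : ‖B‖ ≤ 1) (a : Fin (S.n i)) : 0 ≤ S.mass B a := by
  refine (norm_nonneg _).trans (S.norm_mean_le_mean_norm (f := S.column B a) (C := 1) ?_)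
  exact S.norm_column_le hB a

lemma sum_mass_le (hB : ‖B‖ ≤ 1) : ∑ a, S.mass B a ≤ 1 := by
  unfold mass
  rw [← S.mean_sum Finset.univ (f := fun a t => ‖S.column B a t‖) (C := 1)
    (fun a t => by simpa using S.norm_column_le hB a t)]
  refine (le_abs_self _).trans (S.norm_mean_le (𝕜 := ℝ) fun t => ?_)
  rw [Real.norm_of_nonneg (Finset.sum_nonneg fun a _ => norm_nonneg _)]
  exact EllInfty.sum_norm_coord_le B hB t

/-- The density on the points of level `i` which represents the functional
`x ↦ mean (osc h * B (x 1_W))`. -/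
noncomputable def density (B : (Fin (S.n i) → 𝕜) →L[𝕜] EllInfty 𝕜) (W : Finset (Fin (S.n i)))
    (h : S.Index) (a : Fin (S.n i)) : 𝕜 :=
  if a ∈ W then S.n i * S.mean (fun t => S.osc h t * S.column B a t) else 0

lemma mean_osc_cut (hB : ‖B‖ ≤ 1) (W : Finset (Fin (S.n i))) (h : S.Index) (k : Fin (S.N i)) :
    S.mean (fun t => S.osc h t * EllInfty.coord t (B (S.cut 𝕜 i k W))) =
      (∑ a, S.density B W h a * (S.sgn i k a : 𝕜)) / (S.n i : 𝕜) := by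
  have h1 : ∀ t, S.osc h t * EllInfty.coord t (B (S.cut 𝕜 i k W)) =
      ∑ a, S.cut 𝕜 i k W a * (S.osc h t * S.column B a t) := by
    intro t
    conv_lhs => rw [pi_eq_sum_univ' (S.cut 𝕜 i k W)]
    simp only [map_sum, map_smul, smul_eq_mul, Finset.mul_sum, column]
    exact Finset.sum_congr rfl fun a _ => by ring
  have h2 : ∀ a t, ‖S.osc h t * S.column B a t‖ ≤ 1 := fun a t => by
    simpa [S.norm_osc] using S.norm_column_le hB a t
  simp only [h1]
  rw [S.mean_sum Finset.univ (f := fun a t => S.cut 𝕜 i k W a * (S.osc h t * S.column B a t))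
    (C := 1), Finset.sum_div]
  · refine Finset.sum_congr rfl fun a _ => ?_
    rw [S.mean_const_mul (S.cut 𝕜 i k W a) (h2 a)]
    have := S.n_ne_zero (𝕜 := 𝕜) i
    unfold cut density
    split_ifs
    · field_simp
    · simp
  · intro a t
    rw [norm_mul]
    refine mul_le_one₀ ?_ (norm_nonneg _) (h2 a t)
    unfold cut
    split_ifs
    · exact (S.norm_sgn i k a).le
    · simp

lemma norm_density_le (hB : ‖B‖ ≤ 1) {W : Finset (Fin (S.n i))} {C : ℝ} (hC : 0 ≤ C)
    (hW : ∀ a ∈ W, S.mass B a * S.n i ≤ C) (h : S.Index) (a : Fin (S.n i)) :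
    ‖S.density B W h a‖ ≤ C := by
  unfold density
  split_ifs with ha
  · rw [norm_mul, RCLike.norm_natCast, mul_comm]
    refine le_trans ?_ (hW a ha)
    gcongr
    exact S.norm_mean_osc_column_le hB h a
  · simpa using hC

lemma sum_norm_density_sq_le (hB : ‖B‖ ≤ 1) (W : Finset (Fin (S.n i))) (H : Finset S.Index)
    {j : ℕ} (hj : ∀ h ∈ H, j ≤ h.1) :
    ∑ h ∈ H, ∑ a, ‖S.density B W h a‖ ^ 2 ≤
      (S.n i : ℝ) ^ 2 * (1 + H.card * (S.R j : ℝ)⁻¹) := by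
  rw [Finset.sum_comm]
  have h1 : ∀ a, ∑ h ∈ H, ‖S.density B W h a‖ ^ 2 ≤
      (S.n i : ℝ) ^ 2 * ((1 + H.card * (S.R j : ℝ)⁻¹) * S.mass B a) := by
    intro a
    have h0 := S.mass_nonneg hB a
    by_cases ha : a ∈ W
    · simp only [density, ha, if_true, norm_mul, RCLike.norm_natCast, mul_pow]
      rw [← Finset.mul_sum]
      refine mul_le_mul_of_nonneg_left ?_ (by positivity)
      refine (S.sum_norm_mean_osc_sq_le H hj (S.norm_column_le hB a)).trans ?_
      refine mul_le_mul_of_nonneg_left ?_ (by positivity)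
      refine S.mean_mono (C := 1) (D := 1) (fun t => ?_) (fun t => ?_) (fun t => ?_)
      · simpa using pow_le_one₀ (n := 2) (norm_nonneg _) (S.norm_column_le hB a t)
      · simpa using S.norm_column_le hB a t
      · exact pow_le_of_le_one (norm_nonneg _) (S.norm_column_le hB a t) two_ne_zero
    · simp only [density, ha, if_false, norm_zero, ne_eq, OfNat.ofNat_ne_zero, not_false_eq_true,
        zero_pow, Finset.sum_const_zero]
      positivity
  refine (Finset.sum_le_sum fun a _ => h1 a).trans ?_
  rw [← Finset.mul_sum, ← Finset.mul_sum]
  refine mul_le_mul_of_nonneg_left ?_ (by positivity)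
  exact mul_le_of_le_one_right (by positivity) (S.sum_mass_le hB)

lemma sq_mul_le_sum_norm_sq {g : Fin (S.n i) → 𝕜} {k : Fin (S.N i)} {ε : ℝ} (hε : 0 ≤ ε)
    (hg : ε ≤ ‖(∑ a, g a * (S.sgn i k a : 𝕜)) / (S.n i : 𝕜)‖) :
    ε ^ 2 * S.n i ≤ ∑ a, ‖g a‖ ^ 2 := by
  have hn : (0 : ℝ) < S.n i := by exact_mod_cast S.n_pos i
  rw [norm_div, RCLike.norm_natCast, le_div_iff₀ hn] at hg
  have h1 : ε * S.n i ≤ ∑ a, ‖g a‖ := by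
    refine hg.trans ((norm_sum_le _ _).trans (le_of_eq ?_))
    exact Finset.sum_congr rfl fun a _ => by rw [norm_mul, S.norm_sgn, mul_one]
  have h2 : (∑ a, ‖g a‖) ^ 2 ≤ S.n i * ∑ a, ‖g a‖ ^ 2 := by
    simpa using sq_sum_le_card_mul_sum_sq (s := Finset.univ) (f := fun a => ‖g a‖)
  have h3 : (ε * S.n i) ^ 2 ≤ S.n i * ∑ a, ‖g a‖ ^ 2 := by
    refine le_trans ?_ h2
    gcongr
  have h4 : (S.n i : ℝ) * (ε ^ 2 * S.n i) ≤ S.n i * ∑ a, ‖g a‖ ^ 2 := by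
    refine le_trans (le_of_eq ?_) h3; ring
  exact le_of_mul_le_mul_left h4 hn

/-- Few sign functions of higher levels are relevant at level `i`. -/
lemma card_relevant_le (hB : ‖B‖ ≤ 1) (W : Finset (Fin (S.n i))) (H : Finset S.Index)
    (hi : ∀ h ∈ H, i < h.1) {ε : ℝ} (hε : 0 < ε) (hεi : 2 / ε ^ 2 ≤ i + 1)
    (hH : ∀ h ∈ H, ∃ k, ε ≤ ‖(∑ a, S.density B W h a * (S.sgn i k a : 𝕜)) / (S.n i : 𝕜)‖) :
    (H.card : ℝ) ≤ 2 / ε ^ 2 * S.n i := by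
  have hn : (0 : ℝ) < S.n i := by exact_mod_cast S.n_pos i
  have hR : (0 : ℝ) < S.R (i + 1) := by exact_mod_cast S.R_pos (i + 1)
  have h1 : H.card * (ε ^ 2 * S.n i) ≤ (S.n i : ℝ) ^ 2 * (1 + H.card * (S.R (i + 1) : ℝ)⁻¹) := by
    refine le_trans ?_ (S.sum_norm_density_sq_le hB W H (j := i + 1) fun h hh => hi h hh)
    rw [← nsmul_eq_mul]
    refine Finset.card_nsmul_le_sum _ _ _ fun h hh => ?_
    obtain ⟨k, hk⟩ := hH h hh
    exact S.sq_mul_le_sum_norm_sq hε.le hk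
  have h2 : (S.n i : ℝ) * (S.R (i + 1) : ℝ)⁻¹ ≤ ε ^ 2 / 2 := by
    have h3 : ((i + 2 : ℕ) : ℝ) * S.n i ≤ S.R (i + 1) := by
      exact_mod_cast S.mul_n_le (Nat.lt_succ_self i)
    push_cast at h3
    rw [div_le_iff₀ (by positivity)] at hεi
    rw [← div_eq_mul_inv, div_le_iff₀ hR]
    nlinarith [mul_le_mul_of_nonneg_left h3 (show (0 : ℝ) ≤ ε ^ 2 / 2 by positivity),
      mul_pos hn (pow_pos hε 2)]
  have h4 : (H.card : ℝ) * ε ^ 2 ≤ S.n i + H.card * (ε ^ 2 / 2) := by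
    have h5 : (S.n i : ℝ) * (H.card * ε ^ 2) ≤
        S.n i * (S.n i + H.card * (S.n i * (S.R (i + 1) : ℝ)⁻¹)) := by
      refine le_trans (le_of_eq ?_) (h1.trans (le_of_eq ?_)) <;> ring
    refine (le_of_mul_le_mul_left h5 hn).trans ?_
    gcongr
  rw [div_mul_eq_mul_div, le_div_iff₀ (by positivity)]
  linarith

/-- Each density is correlated with few sign functions of level `i`. -/
lemma card_correlated_le {g : Fin (S.n i) → 𝕜} {C ε : ℝ} (hε : 0 < ε) (hg : ∀ a, ‖g a‖ ≤ C)
    (hi : 2 * C ^ 2 / ε ^ 2 ≤ i + 1) (A : Finset (Fin (S.N i)))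
    (hA : ∀ k ∈ A, ε ≤ ‖(∑ a, g a * (S.sgn i k a : 𝕜)) / (S.n i : 𝕜)‖) :
    (A.card : ℝ) ≤ 2 * C ^ 2 / ε ^ 2 := by
  have h1 := S.card_mul_sq_le A hε.le hg hA
  have hR : (0 : ℝ) < S.R i := by exact_mod_cast S.R_pos i
  have h2 : C ^ 2 * (S.R i : ℝ)⁻¹ ≤ ε ^ 2 / 2 := by
    have h3 : ((i + 1 : ℕ) : ℝ) ≤ S.R i := by exact_mod_cast S.le_R i
    push_cast at h3
    have h4 := hi.trans h3
    rw [div_le_iff₀ (by positivity)] at h4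
    rw [← div_eq_mul_inv, div_le_iff₀ hR]
    linarith
  rw [le_div_iff₀ (by positivity)]
  have h5 := mul_le_mul_of_nonneg_left h2 (Nat.cast_nonneg (α := ℝ) A.card)
  nlinarith

lemma smallAt_op {L : Set ℕ} (hi : i ∉ L) {ε : ℝ} (hε : 0 < ε) (h1 : 2 / ε ^ 2 ≤ i + 1)
    (h2 : 2 * (1 / ε) ^ 2 / ε ^ 2 ≤ i + 1)
    (h3 : 2 * (1 / ε) ^ 2 / ε ^ 2 * (1 + 2 / ε ^ 2) / ε ≤ i + 1) :
    S.SmallAt (S.op L : EllInfty 𝕜 →L[𝕜] EllInfty 𝕜) ε i := by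
  classical
  intro B hB
  have hn : (0 : ℝ) < S.n i := by exact_mod_cast S.n_pos i
  refine ⟨Finset.univ.filter fun a => S.mass B a * S.n i ≤ 1 / ε, ?_, ?_⟩
  · set V := (Finset.univ.filter fun a => S.mass B a * S.n i ≤ 1 / ε)ᶜ with hV
    have h4 : V.card * (1 / ε) ≤ ∑ a ∈ V, S.mass B a * S.n i := by
      rw [← nsmul_eq_mul]
      refine Finset.card_nsmul_le_sum _ _ _ fun a ha => ?_
      simp only [hV, Finset.compl_filter, Finset.mem_filter, Finset.mem_univ, true_and,
        not_le] at ha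
      exact ha.le
    have h5 : ∑ a ∈ V, S.mass B a * S.n i ≤ S.n i := by
      rw [← Finset.sum_mul]
      refine mul_le_of_le_one_left hn.le (le_trans ?_ (S.sum_mass_le hB))
      exact Finset.sum_le_sum_of_subset_of_nonneg (Finset.subset_univ _)
        fun a _ _ => S.mass_nonneg hB a
    have h6 := h4.trans h5
    rw [mul_one_div, div_le_iff₀ hε] at h6
    linarith
  · intro W hW A hA
    have hd := fun h => S.norm_density_le hB (W := W) (C := 1 / ε) (by positivity)
      (fun a ha => (Finset.mem_filter.1 (hW ha)).2) h
    have h4 : ∀ k : Fin (S.N i), ∃ h : S.Index, k ∈ A → h.1 ∈ L ∧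
        ε < ‖(∑ a, S.density B W h a * (S.sgn i k a : 𝕜)) / (S.n i : 𝕜)‖ := by
      intro k
      by_cases hk : k ∈ A
      · obtain ⟨h, hh, hlt⟩ := S.exists_lt_norm_mean_of_lt_norm_op hε.le (hA k hk)
        exact ⟨h, fun _ => ⟨hh, by rwa [S.mean_osc_cut hB] at hlt⟩⟩
      · exact ⟨⟨i, k⟩, fun hk' => absurd hk' hk⟩
    choose w hw using h4
    set D : ℝ := 2 * (1 / ε) ^ 2 / ε ^ 2 with hD
    have hfib : ∀ h ∈ A.image w, (A.filter fun k => w k = h).card ≤ ⌊D⌋₊ := by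
      intro h _
      refine Nat.le_floor (S.card_correlated_le hε (hd h) h2 _ fun k hk => ?_)
      obtain ⟨hk1, rfl⟩ := Finset.mem_filter.1 hk
      exact (hw k hk1).2.le
    have hD0 : 0 ≤ D := by positivity
    have h5 : (A.card : ℝ) ≤ D * (A.image w).card := by
      have h6 := Finset.card_le_mul_card_image (f := w) A ⌊D⌋₊ hfib
      have h7 : (A.card : ℝ) ≤ ⌊D⌋₊ * (A.image w).card := by exact_mod_cast h6
      refine h7.trans ?_
      gcongr
      exact Nat.floor_le hD0
    set lo := (A.image w).filter fun h => h.1 < i with hlo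
    set hi' := (A.image w).filter fun h => ¬ h.1 < i with hhi
    have hcard : (A.image w).card = lo.card + hi'.card :=
      (Finset.card_filter_add_card_filter_not _).symm
    have hlow : lo.card ≤ ∑ j ∈ Finset.range i, S.N j := by
      have : lo ⊆ (Finset.range i).sigma fun j => (Finset.univ : Finset (Fin (S.N j))) := by
        intro h hh
        simpa using (Finset.mem_filter.1 hh).2
      simpa using Finset.card_le_card this
    have hhigh : (hi'.card : ℝ) ≤ 2 / ε ^ 2 * S.n i := by
      refine S.card_relevant_le hB W hi' (fun h hh => ?_) hε h1 fun h hh => ?_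
      all_goals
        obtain ⟨hh1, hh2⟩ := Finset.mem_filter.1 hh
        obtain ⟨k, hk, rfl⟩ := Finset.mem_image.1 hh1
      · refine lt_of_le_of_ne (not_lt.1 hh2) fun heq => hi ?_
        rw [heq]
        exact (hw k hk).1
      · exact ⟨k, (hw k hk).2.le⟩
    have hRN : S.R i ≤ S.N i := le_trans (Nat.le_mul_of_pos_right _ (S.n_pos i)) (S.mul_le i)
    have hlow' : (lo.card : ℝ) * (i + 1) ≤ S.N i := by
      have : (i + 1) * lo.card ≤ S.N i :=
        (Nat.mul_le_mul le_rfl hlow).trans ((S.mul_sum_N_le i).trans hRN)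
      rw [mul_comm]
      exact_mod_cast this
    have hn' : (S.n i : ℝ) * (i + 1) ≤ S.N i := by
      have : (i + 1) * S.n i ≤ S.N i := (Nat.mul_le_mul (S.le_R i) le_rfl).trans (S.mul_le i)
      rw [mul_comm]
      exact_mod_cast this
    have h8 : ((A.image w).card : ℝ) * (i + 1) ≤ (1 + 2 / ε ^ 2) * S.N i := by
      rw [hcard]
      push_cast
      have h9 : (hi'.card : ℝ) * (i + 1) ≤ 2 / ε ^ 2 * S.N i := by
        calc (hi'.card : ℝ) * (i + 1) ≤ (2 / ε ^ 2 * S.n i) * (i + 1) := by gcongr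
          _ = 2 / ε ^ 2 * (S.n i * (i + 1)) := by ring
          _ ≤ _ := by gcongr
      linarith
    have h9 : (A.card : ℝ) * (i + 1) ≤ (ε * S.N i) * (i + 1) := by
      calc (A.card : ℝ) * (i + 1) ≤ D * (A.image w).card * (i + 1) := by gcongr
        _ = D * ((A.image w).card * (i + 1)) := by ring
        _ ≤ D * ((1 + 2 / ε ^ 2) * S.N i) := by gcongr
        _ = (D * (1 + 2 / ε ^ 2)) * S.N i := by ring
        _ ≤ ((i + 1) * ε) * S.N i := by
          rw [div_le_iff₀ hε] at h3
          gcongr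
        _ = _ := by ring
    exact le_of_mul_le_mul_right h9 (by positivity)

end

end SignSystem

namespace SignSystem

variable (S : SignSystem) {𝕜 : Type} [RCLike 𝕜]

lemma norm_cut_le (i : ℕ) (k : Fin (S.N i)) (W : Finset (Fin (S.n i))) : ‖S.cut 𝕜 i k W‖ ≤ 1 := by
  refine (pi_norm_le_iff_of_nonneg zero_le_one).2 fun a => ?_
  unfold cut
  split_ifs
  · exact (S.norm_sgn i k a).le
  · simp

variable {S}

lemma SmallAt.of_forall {T X : EllInfty 𝕜 →L[𝕜] EllInfty 𝕜} {δ ε : ℝ} {i : ℕ}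
    (hT : S.SmallAt T δ i) (hδ : δ ≤ ε)
    (h : ∀ B : (Fin (S.n i) → 𝕜) →L[𝕜] EllInfty 𝕜, ‖B‖ ≤ 1 →
      ∃ B' : (Fin (S.n i) → 𝕜) →L[𝕜] EllInfty 𝕜, ‖B'‖ ≤ 1 ∧
        ∀ x, ‖x‖ ≤ 1 → ε < ‖X (B x)‖ → δ < ‖T (B' x)‖) :
    S.SmallAt X ε i := by
  intro B hB
  obtain ⟨B', hB', hx⟩ := h B hB
  obtain ⟨W, hW, hA⟩ := hT B' hB'
  refine ⟨W, hW.trans (by gcongr), fun W' hW' A hk => ?_⟩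
  refine (hA W' hW' A fun k hkA => hx _ (S.norm_cut_le i k W') (hk k hkA)).trans (by gcongr)

lemma SmallAt.add {T X : EllInfty 𝕜 →L[𝕜] EllInfty 𝕜} {ε : ℝ} {i : ℕ}
    (hT : S.SmallAt T (ε / 2) i) (hX : S.SmallAt X (ε / 2) i) : S.SmallAt (T + X) ε i := by
  classical
  intro B hB
  obtain ⟨V, hV, hVA⟩ := hT B hB
  obtain ⟨W, hW, hWA⟩ := hX B hB
  refine ⟨V ∩ W, ?_, fun W' hW' A hk => ?_⟩
  · rw [Finset.compl_inter]
    have : ((Vᶜ ∪ Wᶜ).card : ℝ) ≤ Vᶜ.card + Wᶜ.card := by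
      exact_mod_cast Finset.card_union_le _ _
    linarith
  · have h1 := hVA W' (hW'.trans Finset.inter_subset_left)
      (A.filter fun k => ε / 2 < ‖T (B (S.cut 𝕜 i k W'))‖) fun k hk' => (Finset.mem_filter.1 hk').2
    have h2 := hWA W' (hW'.trans Finset.inter_subset_right)
      (A.filter fun k => ¬ ε / 2 < ‖T (B (S.cut 𝕜 i k W'))‖) fun k hk' => by
        obtain ⟨hk1, hk2⟩ := Finset.mem_filter.1 hk'
        have h3 := hk k hk1
        rw [add_apply] at h3
        have := norm_add_le (T (B (S.cut 𝕜 i k W'))) (X (B (S.cut 𝕜 i k W')))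
        linarith
    have h3 := Finset.card_filter_add_card_filter_not (s := A)
      fun k => ε / 2 < ‖T (B (S.cut 𝕜 i k W'))‖
    rw [← h3, Nat.cast_add]
    linarith

variable (S)

lemma not_smallAt_op {M : Set ℕ} {i : ℕ} (hi : i ∈ M) :
    ¬ S.SmallAt (S.op M : EllInfty 𝕜 →L[𝕜] EllInfty 𝕜) (1 / 3) i := by
  intro hS
  have hn : (0 : ℝ) < S.n i := by exact_mod_cast S.n_pos i
  let B : (Fin (S.n i) → 𝕜) →L[𝕜] EllInfty 𝕜 := LinearMap.mkContinuous
    { toFun := fun x => EllInfty.ofBounded (fun t => x (S.digit i t))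
        (fun t => norm_le_pi_norm x (S.digit i t))
      map_add' := fun x y => EllInfty.ext_coord fun r => by simp
      map_smul' := fun c x => EllInfty.ext_coord fun r => by simp }
    1 (fun x => by
      rw [one_mul]
      exact EllInfty.norm_le_of_forall (norm_nonneg _) fun t => norm_le_pi_norm x (S.digit i t))
  obtain ⟨W, hW, hA⟩ := hS B (LinearMap.mkContinuous_norm_le _ zero_le_one _)
  have hcard : (Wᶜ.card : ℝ) + W.card = S.n i := by
    have := Finset.card_compl_add_card W
    rw [Fintype.card_fin] at this
    exact_mod_cast this
  have h1 := hA W subset_rfl Finset.univ fun k _ => by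
    refine lt_of_lt_of_le ?_ (S.norm_mean_osc_mul_le_norm_op (h := ⟨i, k⟩) hi _)
    have h2 : ∀ t, S.osc ⟨i, k⟩ t * EllInfty.coord t (B (S.cut 𝕜 i k W)) =
        (fun a => (S.sgn i k a : 𝕜) * S.cut 𝕜 i k W a) (S.digit i t) := fun t => rfl
    simp only [h2]
    rw [S.mean_digit (fun a => (S.sgn i k a : 𝕜) * S.cut 𝕜 i k W a)]
    have h3 : ∑ a, (S.sgn i k a : 𝕜) * S.cut 𝕜 i k W a = (W.card : 𝕜) := by
      simp [cut, ← RCLike.ofReal_mul, S.sgn_mul_self]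
    rw [h3, norm_div, RCLike.norm_natCast, RCLike.norm_natCast, lt_div_iff₀ hn]
    linarith
  have h4 : 0 < S.N i := lt_of_lt_of_le (S.n_pos i) (S.n_le_N i)
  have h5 : (0 : ℝ) < S.N i := by exact_mod_cast h4
  rw [Finset.card_univ, Fintype.card_fin] at h1
  linarith

/-- The operators which are eventually small at the levels belonging to `M`. -/
def smallOperators (𝕜 : Type) [RCLike 𝕜] (M : Set ℕ) : Set (EllInfty 𝕜 →L[𝕜] EllInfty 𝕜) :=
  {T | ∀ ε > 0, ∃ i₀, ∀ i ≥ i₀, i ∈ M → S.SmallAt T ε i}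

variable {S}

lemma smallOperators_of_forall {M : Set ℕ} {T X : EllInfty 𝕜 →L[𝕜] EllInfty 𝕜}
    (hT : T ∈ S.smallOperators 𝕜 M)
    (h : ∀ ε > 0, ∃ δ > 0, ∀ i, S.SmallAt T δ i → S.SmallAt X ε i) :
    X ∈ S.smallOperators 𝕜 M := by
  intro ε hε
  obtain ⟨δ, hδ, hi⟩ := h ε hε
  obtain ⟨i₀, h₀⟩ := hT δ hδ
  exact ⟨i₀, fun i hi₀ hM => hi i (h₀ i hi₀ hM)⟩

lemma mul_mem_smallOperators_left {M : Set ℕ} (A : EllInfty 𝕜 →L[𝕜] EllInfty 𝕜)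
    {T : EllInfty 𝕜 →L[𝕜] EllInfty 𝕜} (hT : T ∈ S.smallOperators 𝕜 M) :
    A * T ∈ S.smallOperators 𝕜 M := by
  refine smallOperators_of_forall hT fun ε hε => ⟨ε / (‖A‖ + 1), by positivity, fun i hi => ?_⟩
  refine hi.of_forall (div_le_self hε.le (by linarith [norm_nonneg A])) fun B hB =>
    ⟨B, hB, fun x _ hx => ?_⟩
  rw [div_lt_iff₀ (by positivity)]
  refine lt_of_lt_of_le hx ((A.le_opNorm (T (B x))).trans ?_)
  nlinarith [norm_nonneg (T (B x))]

lemma mul_mem_smallOperators_right {M : Set ℕ} (A : EllInfty 𝕜 →L[𝕜] EllInfty 𝕜)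
    {T : EllInfty 𝕜 →L[𝕜] EllInfty 𝕜} (hT : T ∈ S.smallOperators 𝕜 M) :
    T * A ∈ S.smallOperators 𝕜 M := by
  refine smallOperators_of_forall hT fun ε hε => ⟨ε / (‖A‖ + 1), by positivity, fun i hi => ?_⟩
  have hA : 0 < ‖A‖ + 1 := by positivity
  have hc : ‖((‖A‖ + 1)⁻¹ : 𝕜)‖ = (‖A‖ + 1)⁻¹ := by
    rw [show ((‖A‖ + 1)⁻¹ : 𝕜) = (((‖A‖ + 1)⁻¹ : ℝ) : 𝕜) by push_cast; rfl, RCLike.norm_ofReal,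
      abs_of_pos (inv_pos.2 hA)]
  refine hi.of_forall (div_le_self hε.le (by linarith [norm_nonneg A])) fun B hB =>
    ⟨((‖A‖ + 1)⁻¹ : 𝕜) • A.comp B, ?_, fun x _ hx => ?_⟩
  · rw [norm_smul, hc, inv_mul_le_iff₀ hA, mul_one]
    refine (A.opNorm_comp_le B).trans ?_
    nlinarith [norm_nonneg A]
  · rw [smul_apply, map_smul, norm_smul, hc, div_eq_inv_mul]
    exact mul_lt_mul_of_pos_left hx (inv_pos.2 hA)

lemma isClosed_smallOperators (M : Set ℕ) : IsClosed (S.smallOperators 𝕜 M) := by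
  refine isClosed_of_closure_subset fun T hT ε hε => ?_
  obtain ⟨X, hX, hTX⟩ := Metric.mem_closure_iff.1 hT (ε / 2) (by positivity)
  obtain ⟨i₀, h₀⟩ := hX (ε / 2) (by positivity)
  refine ⟨i₀, fun i hi hM => (h₀ i hi hM).of_forall (by linarith) fun B hB =>
    ⟨B, hB, fun x hx hlt => ?_⟩⟩
  have h1 : ‖T (B x) - X (B x)‖ ≤ ε / 2 := by
    rw [← sub_apply]
    refine ((T - X).le_opNorm _).trans ?_
    have h2 : ‖B x‖ ≤ 1 := (B.le_opNorm x).trans (mul_le_one₀ hB (norm_nonneg _) hx)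
    rw [dist_eq_norm] at hTX
    nlinarith [norm_nonneg (T - X), norm_nonneg (B x)]
  have h3 := norm_sub_norm_le (T (B x)) (X (B x))
  linarith

variable (S)

/-- The closed ideal of operators which are eventually small at the levels belonging to `M`. -/
noncomputable def smallIdeal (𝕜 : Type) [RCLike 𝕜] (M : Set ℕ) :
    TwoSidedIdeal (EllInfty 𝕜 →L[𝕜] EllInfty 𝕜) :=
  TwoSidedIdeal.mk' (S.smallOperators 𝕜 M)
    (fun ε hε => ⟨0, fun i _ _ B _ => ⟨Finset.univ, by simp; positivity, fun W' _ A hA => by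
      have : A = ∅ := Finset.eq_empty_of_forall_notMem fun k hk => by
        have := hA k hk
        simp at this
        linarith
      rw [this]; simp; positivity⟩⟩)
    (fun {T X} hT hX ε hε => by
      obtain ⟨i₁, h₁⟩ := hT (ε / 2) (by positivity)
      obtain ⟨i₂, h₂⟩ := hX (ε / 2) (by positivity)
      exact ⟨max i₁ i₂, fun i hi hM => (h₁ i (le_trans (le_max_left _ _) hi) hM).add
        (h₂ i (le_trans (le_max_right _ _) hi) hM)⟩)
    (fun {T} hT => by simpa using mul_mem_smallOperators_left (-1) hT)
    (fun {A _} hT => mul_mem_smallOperators_left A hT)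
    (fun {_ A} hT => mul_mem_smallOperators_right A hT)

lemma coe_smallIdeal (M : Set ℕ) :
    (S.smallIdeal 𝕜 M : Set (EllInfty 𝕜 →L[𝕜] EllInfty 𝕜)) = S.smallOperators 𝕜 M :=
  TwoSidedIdeal.coe_mk' _ _ _ _ _ _

lemma op_mem_smallOperators {L M : Set ℕ} (h : (L ∩ M).Finite) :
    S.op L ∈ S.smallOperators 𝕜 M := by
  intro ε hε
  obtain ⟨b, hb⟩ := h.bddAbove
  obtain ⟨m, hm⟩ := exists_nat_ge (max (2 / ε ^ 2) (max (2 * (1 / ε) ^ 2 / ε ^ 2)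
    (2 * (1 / ε) ^ 2 / ε ^ 2 * (1 + 2 / ε ^ 2) / ε)))
  refine ⟨max (b + 1) m, fun i hi hM => ?_⟩
  have hm' : (m : ℝ) ≤ i + 1 := by
    have : m ≤ i + 1 := (le_max_right _ _).trans (hi.trans (Nat.le_succ i))
    exact_mod_cast this
  have h1 := hm.trans hm'
  simp only [max_le_iff] at h1
  refine S.smallAt_op (fun hL => ?_) hε h1.1 h1.2.1 h1.2.2
  have h2 : i ≤ b := hb ⟨hL, hM⟩
  have h3 : b + 1 ≤ i := (le_max_left _ _).trans hi
  omega

lemma op_notMem_smallOperators {M : Set ℕ} (h : M.Infinite) :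
    S.op M ∉ S.smallOperators 𝕜 M := by
  intro hop
  obtain ⟨i₀, h₀⟩ := hop (1 / 3) (by norm_num)
  obtain ⟨i, hi, hlt⟩ := h.exists_gt i₀
  exact S.not_smallAt_op hi (h₀ i hlt.le hi)

end SignSystem

/-- The codes of the initial segments of a binary sequence. -/
def branch (f : ℕ → Bool) : Set ℕ :=
  Set.range fun n => Encodable.encode ((List.range n).map f)

lemma branch_infinite (f : ℕ → Bool) : (branch f).Infinite := by
  refine Set.infinite_range_of_injective fun m n h => ?_
  simpa using congrArg List.length (Encodable.encode_injective h)

lemma branch_inter_finite {f g : ℕ → Bool} (h : f ≠ g) : (branch f ∩ branch g).Finite := by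
  obtain ⟨m, hm⟩ := Function.ne_iff.1 h
  refine ((Set.finite_Iic m).image fun n => Encodable.encode ((List.range n).map f)).subset ?_
  rintro _ ⟨⟨n, rfl⟩, ⟨n', hn'⟩⟩
  refine ⟨n, ?_, rfl⟩
  have h1 := Encodable.encode_injective hn'
  have h2 : n' = n := by simpa using congrArg List.length h1
  subst h2
  by_contra hlt
  simp only [Set.mem_Iic, not_le] at hlt
  exact hm (List.map_inj_left.1 h1 m (List.mem_range.2 hlt)).symm

theorem theorem4p2 (𝕜 : Type) [RCLike 𝕜] :
    ∃ S : Set (TwoSidedIdeal (EllInfty 𝕜 →L[𝕜] EllInfty 𝕜)),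
      Cardinal.mk S = Cardinal.continuum ∧
        ∀ I ∈ S, IsClosed (I : Set (EllInfty 𝕜 →L[𝕜] EllInfty 𝕜)) := by
  obtain ⟨S⟩ := SignSystem.nonempty
  refine ⟨Set.range fun f : ℕ → Bool => S.smallIdeal 𝕜 (branch f), ?_, ?_⟩
  · rw [Cardinal.mk_range_eq]
    · simp
    · intro f g hfg
      by_contra hne
      have h1 : S.op (branch f) ∈ S.smallOperators 𝕜 (branch g) :=
        S.op_mem_smallOperators (branch_inter_finite hne)
      rw [← S.coe_smallIdeal, ← show S.smallIdeal 𝕜 (branch f) = S.smallIdeal 𝕜 (branch g) from hfg,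
        S.coe_smallIdeal] at h1
      exact S.op_notMem_smallOperators (branch_infinite f) h1
  · rintro _ ⟨f, rfl⟩
    rw [S.coe_smallIdeal]
    exact SignSystem.isClosed_smallOperators _
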